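/- Let $n\ge 2$ be an integer. The graceful colouring of the complete graph $K_{n+1}$ on the vertex set $\{0,1,\dots,n\}$ gives the edge $ij$ the colour $|i-j|$. An edge-colouring of $K_{n+1}$ is called nice if it uses exactly $n$ colours and its colour classes have sizes $1,2,\dots,n$. For a nice colouring let $C_i$ be the colour class of size $i$, let $G_i$ be the subgraph of $K_{n+1}$ formed by the edges of $C_i$ and their endpoints, and let $V(G_i)$ be the set of vertices of $G_i$. A nice colouring is called beautiful if every $G_i$, $1\le i\le n$, is acyclic and there is a partition $\{V_1,V_2\}$ of the vertex set of $K_{n+1}$ with $|V_1|=\lfloor\frac{n+1}{2}\rfloor$ and $|V_2|=\lceil\frac{n+1}{2}\rceil$ such that: (i) the union of the classes $C_i$ with $i\equiv n \pmod 2$ is the edge set of the complete bipartite graph with parts $V_1$ and $V_2$; (ii) for every $i\equiv n\pmod 2$, $|V(G_i)\cap V_1|=\lfloor |V(G_i)|/2\rfloor$ and $|V(G_i)\cap V_2|=\lceil |V(G_i)|/2\rceil$; (iii) for every $i\not\equiv n\pmod 2$, exactly $\lfloor i/2\rfloor$ edges of $C_i$ have both ends in $V_1$ and exactly $\lceil i/2\rceil$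 edges of $C_i$ have both ends in $V_2$. Then the graceful colouring of $K_{n+1}$ is beautiful, and $K_{n+1}$ has at least $2^{\lfloor (n-1)/2\rfloor}$ distinct spanning trees that are heterochromatic, that is, whose edges have pairwise different colours in the graceful colouring. -/

import Mathlib

/-- The graceful colouring of the complete graph on `{0, 1, …, n}`: the edge `ij` gets the colour
`|i - j|`. -/
def gracefulColouring (n : ℕ) : SimpleGraph.TopEdgeLabeling (Fin (n + 1)) ℕ :=
  SimpleGraph.EdgeLabeling.mk (fun i j _ => ((i : ℤ) - (j : ℤ)).natAbs)
    (fun i j _ => by omega)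

namespace SimpleGraph.EdgeLabeling

/-- A subgraph `H` (given by its edges) of an edge-coloured graph is heterochromatic if distinct
edges of `H` have distinct colours. -/
def IsHeterochromatic {V K : Type*} {G : SimpleGraph V} (C : G.EdgeLabeling K)
    (H : SimpleGraph V) : Prop :=
  ∀ e f : G.edgeSet, e.1 ∈ H.edgeSet → f.1 ∈ H.edgeSet → C e = C f → e = f

/-- The heterochromatic spanning trees of an edge-coloured graph. -/
def heterochromaticSpanningTrees {V K : Type*} {G : SimpleGraph V} (C : G.EdgeLabeling K) :
    Set (SimpleGraph V) :=
  {T | T ≤ G ∧ T.IsTree ∧ C.IsHeterochromatic T}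

/-- The size of the colour class of `k`. -/
noncomputable def classSize {V K : Type*} {G : SimpleGraph V} (C : G.EdgeLabeling K) (k : K) : ℕ :=
  (C.labelGraph k).edgeSet.ncard

/-- A colouring of `K_{n+1}` is nice if it uses exactly `n` colours and the colour classes have
sizes `1, 2, …, n`. -/
def IsNice {n : ℕ} {K : Type*} (C : TopEdgeLabeling (Fin (n + 1)) K) : Prop :=
  Set.BijOn C.classSize (Set.range C) (Set.Icc 1 n)

/-- Beautiful colourings of `K_{n+1}`. For a nice colouring, a used colour `k` is determined by the
size `i = C.classSize k` of its class, so `C.labelGraph k` is the graph `G_i` spanned by the class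
`C_i` of size `i`, and its `support` is `V(G_i)`. -/
structure IsBeautiful {n : ℕ} {K : Type*} (C : TopEdgeLabeling (Fin (n + 1)) K) : Prop where
  nice : C.IsNice
  acyclic : ∀ k ∈ Set.range C, (C.labelGraph k).IsAcyclic
  exists_partition : ∃ V₁ V₂ : Set (Fin (n + 1)), IsCompl V₁ V₂ ∧
    V₁.ncard = (n + 1) / 2 ∧ V₂.ncard = (n + 2) / 2 ∧
    -- the classes `C_i` with `i ≡ n (mod 2)` form the complete bipartite graph on `V₁, V₂`
    (⨆ k ∈ {k ∈ Set.range C | C.classSize k ≡ n [MOD 2]}, C.labelGraph k) =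
      (⊤ : SimpleGraph (Fin (n + 1))).between V₁ V₂ ∧
    -- balance of the vertices of the classes with `i ≡ n (mod 2)`
    (∀ k ∈ Set.range C, C.classSize k ≡ n [MOD 2] →
      ((C.labelGraph k).support ∩ V₁).ncard = (C.labelGraph k).support.ncard / 2 ∧
      ((C.labelGraph k).support ∩ V₂).ncard = ((C.labelGraph k).support.ncard + 1) / 2) ∧
    -- balance of the edges of the classes with `i ≢ n (mod 2)`
    (∀ k ∈ Set.range C, ¬ C.classSize k ≡ n [MOD 2] →
      {e ∈ (C.labelGraph k).edgeSet | ∀ v ∈ e, v ∈ V₁}.ncard = C.classSize k / 2 ∧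
      {e ∈ (C.labelGraph k).edgeSet | ∀ v ∈ e, v ∈ V₂}.ncard = (C.classSize k + 1) / 2)

end SimpleGraph.EdgeLabeling

open SimpleGraph

section Acyclic

/-! Colour `k` joins `j` to `j + k`, so its class has `n + 1 - k` edges and is a union of paths; its
size is congruent to `n` mod 2 exactly when `k` is odd. Splitting the vertices by parity therefore
gives the partition: odd colours cross it, even colours preserve it, and the balance conditions
become counts of odd and even numbers in intervals. The trees are double stars with centres `0` and
`n`. An inner leaf `v` uses colour `v` at `0` and `n - v` at `n`, so colours stay distinct when `v`
and `n - v` choose the same centre. Each of the `(n - 1) / 2` pairs with `v < n - v` chooses freely.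
-/

/-- A graph is acyclic if, for some height function, every vertex has at most one neighbour that is
not higher than itself. -/
theorem SimpleGraph.isAcyclic_of_unique_lower_neighbour {V : Type*} {G : SimpleGraph V}
    (f : V → ℕ)
    (h : ∀ v u w, G.Adj v u → G.Adj v w → f u ≤ f v → f w ≤ f v → u = w) : G.IsAcyclic := by
  classical
  intro v c hc
  -- At a highest vertex of a cycle, both cycle neighbours are not higher, hence equal, which is
  -- impossible.
  obtain ⟨x, hx, hmax⟩ := c.support.toFinset.exists_max_image f ⟨v, by simp⟩
  simp only [List.mem_toFinset] at hx hmax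
  have hcyc := hc.rotate hx
  refine hcyc.snd_ne_penultimate (h x _ _ (Walk.adj_snd hcyc.not_nil)
    (Walk.adj_penultimate hcyc.not_nil).symm (hmax _ ?_) (hmax _ ?_))
  · exact (c.mem_support_rotate_iff x hx).1 (Walk.getVert_mem_support _ _)
  · exact (c.mem_support_rotate_iff x hx).1 (Walk.getVert_mem_support _ _)

end Acyclic

section Parity

theorem Nat.card_filter_odd_range (m : ℕ) : ((Finset.range m).filter Odd).card = m / 2 := by
  induction m with
  | zero => simp
  | succ m ih =>
    rw [Finset.range_add_one, Finset.filter_insert]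
    split_ifs with h
    · rw [Finset.card_insert_of_notMem (by simp), ih]
      rw [Nat.odd_iff] at h
      omega
    · rw [ih]
      rw [Nat.odd_iff] at h
      omega

theorem Nat.card_filter_even_range (m : ℕ) :
    ((Finset.range m).filter Even).card = (m + 1) / 2 := by
  have h := Finset.card_filter_add_card_filter_not (s := Finset.range m) Even
  rw [Finset.card_range, Finset.filter_congr fun x _ => Nat.not_even_iff_odd,
    Nat.card_filter_odd_range] at h
  omega

/-- Truncated subtraction covers `b ≤ a`; this case arises when a colour class touches every vertex.
-/
theorem Nat.card_filter_Ico (P : ℕ → Prop) [DecidablePred P] (a b : ℕ) :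
    ((Finset.Ico a b).filter P).card =
      ((Finset.range b).filter P).card - ((Finset.range a).filter P).card := by
  rcases le_total a b with hab | hab
  · rw [← Finset.card_sdiff_of_subset
      (Finset.filter_subset_filter _ (Finset.range_subset_range.2 hab))]
    congr 1
    ext x
    simp only [Finset.mem_filter, Finset.mem_Ico, Finset.mem_sdiff, Finset.mem_range]
    grind
  · rw [Finset.Ico_eq_empty_of_le hab, Nat.sub_eq_zero_of_le]
    · simp
    · exact Finset.card_le_card
        (Finset.filter_subset_filter _ (Finset.range_subset_range.2 hab))

/-- The number of elements of `{0, …, n}` with a property, outside of an interval. -/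
theorem Fin.ncard_outside_Ico (n a b : ℕ) (hb : b ≤ n + 1) (P : ℕ → Prop) [DecidablePred P] :
    {v : Fin (n + 1) | ((v : ℕ) < a ∨ b ≤ v) ∧ P v}.ncard =
      ((Finset.range (n + 1)).filter P).card -
        (((Finset.range b).filter P).card - ((Finset.range a).filter P).card) := by
  rw [← Set.ncard_image_of_injective _ Fin.val_injective, ← Nat.card_filter_Ico,
    ← Finset.card_sdiff_of_subset, ← Set.ncard_coe_finset]
  · congr 1
    ext x
    simp only [Set.mem_image, Set.mem_ofPred_eq, Finset.coe_sdiff, Finset.coe_filter,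
      Finset.mem_range, Finset.mem_Ico, Set.mem_sdiff]
    constructor
    · rintro ⟨v, ⟨h, hP⟩, rfl⟩
      exact ⟨⟨v.2, hP⟩, by omega⟩
    · rintro ⟨⟨hx, hP⟩, h⟩
      refine ⟨⟨x, hx⟩, ⟨?_, hP⟩, rfl⟩
      by_contra hcon
      exact h ⟨by simp only at hcon; omega, hP⟩
  · intro x
    simp only [Finset.mem_filter, Finset.mem_Ico, Finset.mem_range]
    rintro ⟨⟨_, h⟩, hP⟩
    exact ⟨by omega, hP⟩

theorem Fin.ncard_setOf (n : ℕ) (P : ℕ → Prop) [DecidablePred P] :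
    {v : Fin (n + 1) | P v}.ncard = ((Finset.range (n + 1)).filter P).card := by
  simpa using Fin.ncard_outside_Ico n 0 0 (Nat.zero_le _) P

end Parity

section Graceful

theorem gracefulColouring_apply {n : ℕ} (i j : Fin (n + 1))
    (h : s(i, j) ∈ (⊤ : SimpleGraph (Fin (n + 1))).edgeSet) :
    gracefulColouring n ⟨s(i, j), h⟩ = ((i : ℤ) - (j : ℤ)).natAbs := rfl

theorem gracefulColouring_get {n : ℕ} (i j : Fin (n + 1))
    (h : (⊤ : SimpleGraph (Fin (n + 1))).Adj i j) :
    (gracefulColouring n).get i j h = ((i : ℤ) - (j : ℤ)).natAbs := rfl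

theorem mem_range_gracefulColouring {n k : ℕ} :
    k ∈ Set.range (gracefulColouring n) ↔ 1 ≤ k ∧ k ≤ n := by
  constructor
  · rintro ⟨⟨e, he⟩, rfl⟩
    induction e using Sym2.inductionOn with
    | hf i j =>
      rw [gracefulColouring_apply]
      have hne : (i : ℕ) ≠ j := fun h => (by simpa using he : i ≠ j) (Fin.ext h)
      omega
  · rintro ⟨h1, h2⟩
    refine ⟨⟨s(⟨0, by omega⟩, ⟨k, by omega⟩), ?_⟩, ?_⟩
    · simp only [mem_edgeSet, top_adj, ne_eq, Fin.mk.injEq]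
      omega
    · rw [gracefulColouring_apply]
      simp

theorem gracefulColouring_labelGraph_adj {n k : ℕ} (hk : 1 ≤ k) (i j : Fin (n + 1)) :
    ((gracefulColouring n).labelGraph k).Adj i j ↔ (i : ℕ) + k = j ∨ (j : ℕ) + k = i := by
  rw [TopEdgeLabeling.labelGraph_adj]
  constructor
  · rintro ⟨h, hk'⟩
    rw [gracefulColouring_get] at hk'
    omega
  · intro h
    refine ⟨?_, ?_⟩
    · rintro rfl
      omega
    · rw [gracefulColouring_get]
      omega

/-- The number of edges of a colour class with both ends in a set that is invariant under
translation by the colour. -/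
theorem ncard_gracefulColouring_class_edges {n k : ℕ} (hk : 1 ≤ k) (P : ℕ → Prop)
    [DecidablePred P] (hP : ∀ j, P (j + k) ↔ P j) :
    {e ∈ ((gracefulColouring n).labelGraph k).edgeSet | ∀ v ∈ e, P (v : Fin (n + 1))}.ncard =
      ((Finset.range (n + 1 - k)).filter P).card := by
  rw [← Set.ncard_coe_finset]
  symm
  -- An edge is determined by its lower endpoint `j`, and invariance of `P` lets `j` decide for both
  -- ends.
  refine Set.ncard_congr
    (fun j hj => s(⟨j, by simp at hj; omega⟩, ⟨j + k, by simp at hj; omega⟩)) ?_ ?_ ?_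
  · intro j hj
    simp only [Finset.coe_filter, Finset.mem_range, Set.mem_ofPred_eq] at hj
    simp only [Set.mem_ofPred_eq, mem_edgeSet, gracefulColouring_labelGraph_adj hk, Sym2.mem_iff]
    refine ⟨Or.inl trivial, ?_⟩
    rintro v (rfl | rfl)
    · exact hj.2
    · exact (hP j).2 hj.2
  · intro i j hi hj h
    simp only [Sym2.eq_iff, Fin.mk.injEq] at h
    omega
  · rintro e ⟨he, hv⟩
    induction e using Sym2.inductionOn with
    | hf i j =>
      rw [mem_edgeSet, gracefulColouring_labelGraph_adj hk] at he
      rcases he with he | he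
      · refine ⟨i, ?_, ?_⟩
        · simp only [Finset.coe_filter, Finset.mem_range, Set.mem_ofPred_eq]
          exact ⟨by omega, hv i (by simp)⟩
        · simp [he]
      · refine ⟨j, ?_, ?_⟩
        · simp only [Finset.coe_filter, Finset.mem_range, Set.mem_ofPred_eq]
          exact ⟨by omega, hv j (by simp)⟩
        · simp [he, Sym2.eq_swap]

theorem classSize_gracefulColouring {n k : ℕ} (hk : 1 ≤ k) :
    (gracefulColouring n).classSize k = n + 1 - k := by
  simpa [EdgeLabeling.classSize] using
    ncard_gracefulColouring_class_edges (n := n) hk (fun _ => True) (by simp)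

theorem support_gracefulColouring_labelGraph {n k : ℕ} (hk : 1 ≤ k) :
    ((gracefulColouring n).labelGraph k).support =
      {v : Fin (n + 1) | (v : ℕ) < n + 1 - k ∨ k ≤ v} := by
  ext v
  simp only [mem_support, gracefulColouring_labelGraph_adj hk, Set.mem_ofPred_eq]
  constructor
  · rintro ⟨w, hw⟩
    omega
  · rintro (h | h)
    · exact ⟨⟨v + k, by omega⟩, Or.inl rfl⟩
    · exact ⟨⟨v - k, by omega⟩, Or.inr (by simp only; omega)⟩

theorem isNice_gracefulColouring (n : ℕ) : (gracefulColouring n).IsNice := by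
  refine ⟨?_, ?_, ?_⟩
  · intro k hk
    rw [mem_range_gracefulColouring] at hk
    rw [classSize_gracefulColouring hk.1, Set.mem_Icc]
    omega
  · intro k hk l hl h
    rw [mem_range_gracefulColouring] at hk hl
    rw [classSize_gracefulColouring hk.1, classSize_gracefulColouring hl.1] at h
    omega
  · intro i hi
    rw [Set.mem_Icc] at hi
    refine ⟨n + 1 - i, mem_range_gracefulColouring.2 (by omega), ?_⟩
    rw [classSize_gracefulColouring (by omega)]
    omega

theorem isAcyclic_gracefulColouring_labelGraph {n k : ℕ} (hk : 1 ≤ k) :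
    ((gracefulColouring n).labelGraph k).IsAcyclic := by
  refine isAcyclic_of_unique_lower_neighbour (fun v => (v : ℕ)) ?_
  intro v u w hu hw huv hwv
  rw [gracefulColouring_labelGraph_adj hk] at hu hw
  ext
  omega

theorem classSize_gracefulColouring_modEq {n k : ℕ} (hk : 1 ≤ k) (hkn : k ≤ n) :
    (gracefulColouring n).classSize k ≡ n [MOD 2] ↔ Odd k := by
  rw [classSize_gracefulColouring hk, Nat.odd_iff, Nat.ModEq]
  omega

theorem isBeautiful_gracefulColouring (n : ℕ) : (gracefulColouring n).IsBeautiful where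
  nice := isNice_gracefulColouring n
  acyclic k hk := isAcyclic_gracefulColouring_labelGraph (mem_range_gracefulColouring.1 hk).1
  exists_partition := by
    -- The odd numbers are the smaller half, as `0` is even.
    refine ⟨{v | Odd (v : ℕ)}, {v | Even (v : ℕ)}, ?_, ?_, ?_, ?_, ?_, ?_⟩
    · rw [← compl_eq_iff_isCompl]
      ext v
      simp
    · rw [Fin.ncard_setOf, Nat.card_filter_odd_range]
    · rw [Fin.ncard_setOf, Nat.card_filter_even_range]
    · ext i j
      simp only [iSup_adj, between_adj, top_adj, Set.mem_ofPred_eq, exists_prop]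
      constructor
      · rintro ⟨k, ⟨hk, hmod⟩, hadj⟩
        rw [mem_range_gracefulColouring] at hk
        rw [classSize_gracefulColouring_modEq hk.1 hk.2, Nat.odd_iff] at hmod
        refine ⟨hadj.ne, ?_⟩
        rw [gracefulColouring_labelGraph_adj hk.1] at hadj
        simp only [Nat.odd_iff, Nat.even_iff]
        omega
      · rintro ⟨-, h⟩
        simp only [Nat.odd_iff, Nat.even_iff] at h
        have hk : 1 ≤ ((i : ℤ) - j).natAbs ∧ ((i : ℤ) - j).natAbs ≤ n := by omega
        refine ⟨((i : ℤ) - j).natAbs, ⟨mem_range_gracefulColouring.2 hk, ?_⟩, ?_⟩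
        · rw [classSize_gracefulColouring_modEq hk.1 hk.2, Nat.odd_iff]
          omega
        · rw [gracefulColouring_labelGraph_adj hk.1]
          omega
    · intro k hk hmod
      rw [mem_range_gracefulColouring] at hk
      rw [classSize_gracefulColouring_modEq hk.1 hk.2, Nat.odd_iff] at hmod
      rw [support_gracefulColouring_labelGraph hk.1]
      have hall := Fin.ncard_outside_Ico n (n + 1 - k) k (by omega) (fun _ => True)
      have hodd := Fin.ncard_outside_Ico n (n + 1 - k) k (by omega) Odd
      have heven := Fin.ncard_outside_Ico n (n + 1 - k) k (by omega) Even
      simp only [and_true, Finset.filter_true, Finset.card_range] at hall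
      simp only [Nat.card_filter_odd_range] at hodd
      simp only [Nat.card_filter_even_range] at heven
      rw [← Set.ofPred_and, ← Set.ofPred_and, hall, hodd, heven]
      omega
    · intro k hk hmod
      rw [mem_range_gracefulColouring] at hk
      rw [classSize_gracefulColouring_modEq hk.1 hk.2, Nat.not_odd_iff_even] at hmod
      rw [classSize_gracefulColouring hk.1]
      constructor
      · rw [← Nat.card_filter_odd_range]
        exact ncard_gracefulColouring_class_edges hk.1 Odd (by simp [Nat.odd_add, hmod])
      · rw [← Nat.card_filter_even_range]
        exact ncard_gracefulColouring_class_edges hk.1 Even (by simp [Nat.even_add, hmod])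

end Graceful

section DoubleStar

/-- The double star on `{0, …, n}` with centres `0` and `n`, where an inner vertex `v` is a leaf at
`n` if `p v` holds and a leaf at `0` otherwise. -/
def doubleStar (n : ℕ) (p : ℕ → Prop) : SimpleGraph (Fin (n + 1)) :=
  SimpleGraph.fromRel fun i j =>
    ((i : ℕ) = 0 ∧ (j : ℕ) = n) ∨ ((i : ℕ) = 0 ∧ 0 < (j : ℕ) ∧ (j : ℕ) < n ∧ ¬ p j) ∨
      ((j : ℕ) = n ∧ 0 < (i : ℕ) ∧ (i : ℕ) < n ∧ p i)

theorem doubleStar_adj {n : ℕ} {p : ℕ → Prop} (hn : 1 ≤ n) {i j : Fin (n + 1)} :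
    (doubleStar n p).Adj i j ↔
      (((i : ℕ) = 0 ∧ (j : ℕ) = n) ∨ ((i : ℕ) = 0 ∧ 0 < (j : ℕ) ∧ (j : ℕ) < n ∧ ¬ p j) ∨
        ((j : ℕ) = n ∧ 0 < (i : ℕ) ∧ (i : ℕ) < n ∧ p i)) ∨
      (((j : ℕ) = 0 ∧ (i : ℕ) = n) ∨ ((j : ℕ) = 0 ∧ 0 < (i : ℕ) ∧ (i : ℕ) < n ∧ ¬ p i) ∨
        ((i : ℕ) = n ∧ 0 < (j : ℕ) ∧ (j : ℕ) < n ∧ p j)) := by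
  rw [doubleStar, fromRel_adj, and_iff_right_iff_imp]
  rintro h rfl
  omega

theorem isTree_doubleStar {n : ℕ} (hn : 1 ≤ n) (p : ℕ → Prop) : (doubleStar n p).IsTree := by
  constructor
  · have hn0 : (doubleStar n p).Reachable (Fin.last n) 0 :=
      Adj.reachable ((doubleStar_adj hn).2 (by simp))
    rw [connected_iff_exists_forall_reachable]
    refine ⟨0, fun v => Reachable.symm ?_⟩
    by_cases h0 : (v : ℕ) = 0
    · rw [show v = 0 from Fin.ext h0]
    by_cases hvn : (v : ℕ) = n
    · rwa [show v = Fin.last n from Fin.ext hvn]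
    have hlt : (v : ℕ) < n := by omega
    by_cases hp : p v
    · refine Reachable.trans (Adj.reachable ((doubleStar_adj hn).2 ?_)) hn0
      simp only [Fin.val_last]
      exact Or.inl (Or.inr (Or.inr ⟨trivial, by omega, hlt, hp⟩))
    · refine Adj.reachable ((doubleStar_adj hn).2 ?_)
      exact Or.inr (Or.inr (Or.inl ⟨rfl, by omega, hlt, hp⟩))
  · refine isAcyclic_of_unique_lower_neighbour
      -- Heights for the tree rooted at `0`, with `n` below all the leaves.
      (fun v => if (v : ℕ) = 0 then 0 else if (v : ℕ) = n then 1 else 2) ?_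
    intro v u w hu hw huv hwv
    rw [doubleStar_adj hn] at hu hw
    ext
    grind

theorem isHeterochromatic_doubleStar {n : ℕ} (hn : 1 ≤ n) {p : ℕ → Prop}
    (hp : ∀ v w, v + w = n → p v → p w) :
    (gracefulColouring n).IsHeterochromatic (doubleStar n p) := by
  have key : ∀ i j k l : Fin (n + 1), (i : ℕ) ≤ j → (k : ℕ) ≤ l → (doubleStar n p).Adj i j →
      (doubleStar n p).Adj k l → ((i : ℤ) - j).natAbs = ((k : ℤ) - l).natAbs →
      i = k ∧ j = l := by
    intro i j k l hij hkl h h' heq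
    rw [doubleStar_adj hn] at h h'
    -- The only clash that arithmetic does not exclude is between a leaf at `0` and a leaf at `n`
    -- whose labels sum to `n`.
    have hil := hp i l
    have hkj := hp k j
    have hdiff : (j : ℕ) + k = l + i := by omega
    clear hp heq
    simp only [Fin.ext_iff]
    rcases h with (h | h | h) | (h | h | h) <;> rcases h' with (h' | h' | h') | (h' | h' | h') <;>
      first
      | omega
      | exact absurd (hkj (by omega) h'.2.2.2) h.2.2.2
      | exact absurd (hil (by omega) h.2.2.2) h'.2.2.2
  have wlog_le : ∀ e : Sym2 (Fin (n + 1)), ∃ i j : Fin (n + 1), (i : ℕ) ≤ j ∧ e = s(i, j) := by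
    intro e
    induction e using Sym2.inductionOn with
    | hf i j =>
      rcases le_total (i : ℕ) j with h | h
      · exact ⟨i, j, h, rfl⟩
      · exact ⟨j, i, h, Sym2.eq_swap⟩
  rintro ⟨e, he⟩ ⟨f, hf⟩ heT hfT heq
  obtain ⟨i, j, hij, rfl⟩ := wlog_le e
  obtain ⟨k, l, hkl, rfl⟩ := wlog_le f
  rw [gracefulColouring_apply, gracefulColouring_apply] at heq
  obtain ⟨rfl, rfl⟩ := key i j k l hij hkl heT hfT heq
  rfl

theorem two_pow_le_ncard_heterochromaticSpanningTrees {n : ℕ} (hn : 1 ≤ n) :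
    2 ^ ((n - 1) / 2) ≤ (gracefulColouring n).heterochromaticSpanningTrees.ncard := by
  let tree (A : Finset ℕ) : SimpleGraph (Fin (n + 1)) :=
    -- The minimum names the pair `{v, n - v}`; a middle vertex `n / 2` is never selected, so it
    -- hangs at `0`.
    doubleStar n fun v => min v (n - v) ∈ A
  let sets : Finset (Finset ℕ) := (Finset.Icc 1 ((n - 1) / 2)).powerset
  have hcard : (sets : Set (Finset ℕ)).ncard = 2 ^ ((n - 1) / 2) := by
    rw [Set.ncard_coe_finset, Finset.card_powerset, Nat.card_Icc, Nat.add_sub_cancel]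
  rw [← hcard]
  refine Set.ncard_le_ncard_of_injOn tree ?_ ?_ (Set.toFinite _)
  · intro A _
    refine ⟨le_top, isTree_doubleStar hn _, isHeterochromatic_doubleStar hn ?_⟩
    rintro v w rfl h
    rwa [Nat.add_sub_cancel_left, min_comm, ← Nat.add_sub_cancel_right v w] at h
  -- The neighbours of `n` in the lower half recover `A`.
  · have key : ∀ A ∈ sets, ∀ a, a ∈ A ↔ ∃ h : 1 ≤ a ∧ a ≤ (n - 1) / 2,
        (tree A).Adj ⟨a, by omega⟩ (Fin.last n) := by
      intro A hA a
      constructor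
      · intro ha
        have hrange := Finset.mem_Icc.1 (Finset.mem_powerset.1 hA ha)
        refine ⟨hrange, (doubleStar_adj hn).2 (Or.inl (Or.inr (Or.inr ⟨rfl, ?_, ?_, ?_⟩)))⟩
        · simp only; omega
        · simp only; omega
        · simp only
          rwa [min_eq_left (by omega)]
      · rintro ⟨hrange, hadj⟩
        have hmin : min a (n - a) = a := min_eq_left (by omega)
        rw [doubleStar_adj hn] at hadj
        simp only [Fin.val_last, hmin] at hadj
        grind
    intro A hA B hB hAB
    ext a
    rw [key A hA, key B hB]
    simp only [hAB]

end DoubleStar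

theorem corollary4 (n : ℕ) (hn : 2 ≤ n) :
    (gracefulColouring n).IsBeautiful ∧
      2 ^ ((n - 1) / 2) ≤ (gracefulColouring n).heterochromaticSpanningTrees.ncard := by
  exact ⟨isBeautiful_gracefulColouring n,
    two_pow_le_ncard_heterochromaticSpanningTrees (by omega)⟩
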